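/- Let $\mathcal{Y}=\{-1,+1\}$, let $\mathcal{X}$ be a measurable space, let $n\ge 1$, and let $f_1,\dots,f_n:\mathcal{X}\to\mathcal{Y}$ be measurable base classifiers. For $\mathbf w\in\mathbb{R}^n$ put $h_{\mathbf w}(x)=\sum_{i=1}^n w_i f_i(x)$, and let $\ell(h_{\mathbf w}(x),y)=\mathbf{I}[\operatorname{sign}(h_{\mathbf w}(x))\neq y]$, where $\operatorname{sign}(0)=0$ (a tie counts as an error). Let $\mathcal{D}$ be a probability distribution on $\mathcal{X}\times\mathcal{Y}$. For $\boldsymbol\alpha\in\mathbb{R}^n$ and a probability distribution $\rho$ over weight vectors $\mathbf w\in\mathbb{R}^n$, put $$b_{\mathcal D}^{\rho}(h_{\boldsymbol\alpha})=\mathbb{E}_{(x,y)\sim\mathcal D}\Big[\mathbb{E}_{\mathbf w\sim\rho}\,\ell(h_{\mathbf w}(x),y)\,\Big|\,\ell(h_{\boldsymbol\alpha}(x),y)=0\Big],\qquad c_{\mathcal D}^{\rho}(h_{\boldsymbol\alpha})=\mathbb{E}_{(x,y)\sim\mathcal D}\Big[\mathbb{E}_{\mathbf w\sim\rho}\,\ell(h_{\mathbf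 w}(x),y)\,\Big|\,\ell(h_{\boldsymbol\alpha}(x),y)=1\Big].$$ Let $\{S,S^c\}$ be any solution of the partition problem for $\boldsymbol\alpha$, that is, $S\subseteq\{1,\dots,n\}$ (possibly $S$ or $S^c$ is empty) minimizes $\big|\sum_{i\in S}\alpha_i-\sum_{i\notin S}\alpha_i\big|$. Put $$\tilde\alpha=\max\Big(\sum_{i\in S}\alpha_i,\sum_{i\notin S}\alpha_i\Big),\qquad \bar\alpha=\Big|\sum_{i\in S}\alpha_i-\sum_{i\notin S}\alpha_i\Big|,\qquad \|\boldsymbol\alpha\|_1=\sum_{i=1}^n|\alpha_i|.$$ Then the following hold, where each bound on $b_{\mathcal D}^{\rho}(h_{\boldsymbol\alpha})$ is claimed if $\mathbb{P}_{\mathcal D}[\ell(h_{\boldsymbol\alpha}(x),y)=0]>0$, and each bound on $c_{\mathcal D}^{\rho}(h_{\boldsymbol\alpha})$ is claimed if $\mathbb{P}_{\mathcal D}[\ell(h_{\boldsymbol\alpha}(x),y)=1]>0$. 1. (Categorical.) If $\alpha_i\ge 0$ for all $i$, $\sum_i\alpha_i=1$, and $\rho=\mathcal{C}(\boldsymbol\alpha)$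 is the distribution giving the $i$-th standard basis vector probability $\alpha_i$, then $$0\le b_{\mathcal D}^{\rho}(h_{\boldsymbol\alpha})\le 1-\tilde\alpha,\qquad \tilde\alpha\le c_{\mathcal D}^{\rho}(h_{\boldsymbol\alpha})\le 1.$$ 2. (Dirichlet.) If $\alpha_i>0$ for all $i$ and $\rho=\operatorname{Dir}(\boldsymbol\alpha)$, then $$0\le b_{\mathcal D}^{\rho}(h_{\boldsymbol\alpha})\le I_{0.5}\big(\tilde\alpha,\ \|\boldsymbol\alpha\|_1-\tilde\alpha\big),\qquad I_{0.5}\big(\|\boldsymbol\alpha\|_1-\tilde\alpha,\ \tilde\alpha\big)\le c_{\mathcal D}^{\rho}(h_{\boldsymbol\alpha})\le 1,$$ where $I_{0.5}(p,q)=\int_0^{0.5}t^{p-1}(1-t)^{q-1}\,dt\,\big/\int_0^{1}t^{p-1}(1-t)^{q-1}\,dt$ for $p,q>0$ is the regularized incomplete beta function at $0.5$, with the limit values $I_{0.5}(p,0)=0$ and $I_{0.5}(0,q)=1$ for $p,q>0$ (needed only for $n=1$). 3. (Gaussian.) If $\rho=\mathcal{N}(\boldsymbol\alpha,\mathbf{I}_{n\times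 n})$, then, with $\Phi(k)=\frac12\big[1-\operatorname{Erf}(k/\sqrt2)\big]$ and $\operatorname{Erf}(k)=\frac{2}{\sqrt\pi}\int_0^k e^{-t^2}\,dt$, $$\Phi\Big(\frac{\|\boldsymbol\alpha\|_1}{\sqrt n}\Big)\le b_{\mathcal D}^{\rho}(h_{\boldsymbol\alpha})\le\Phi\Big(\frac{\bar\alpha}{\sqrt n}\Big),\qquad 1-\Phi\Big(\frac{\bar\alpha}{\sqrt n}\Big)\le c_{\mathcal D}^{\rho}(h_{\boldsymbol\alpha})\le 1-\Phi\Big(\frac{\|\boldsymbol\alpha\|_1}{\sqrt n}\Big).$$ -/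

import Mathlib

open MeasureTheory ProbabilityTheory

noncomputable section

namespace MajorityVote

/-- The label set `{-1, +1}`, with the measurable structure inherited from `ℝ`. -/
abbrev Label : Type := ({-1, 1} : Set ℝ)

/-- The weighted vote `h_w(x) = ∑ i, w i * f i x` (real valued). -/
def vote {X : Type*} {n : ℕ} (f : Fin n → X → Label) (w : Fin n → ℝ) (x : X) : ℝ :=
  ∑ i, w i * (f i x : ℝ)

/-- The 0-1 loss `I[sign v ≠ y]`. Here `Real.sign 0 = 0`, so a tie counts as an error. -/
def loss (v : ℝ) (y : Label) : ℝ :=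
  if Real.sign v ≠ (y : ℝ) then 1 else 0

/-- The expected loss `E_{w ∼ ρ} ℓ(h_w(x), y)` at one example. A distribution over the hypotheses
`h_w` is given as a distribution `ρ` over the weight vectors `w`. -/
def gibbsLoss {X : Type*} {n : ℕ} (f : Fin n → X → Label) (ρ : Measure (Fin n → ℝ))
    (z : X × Label) : ℝ :=
  ∫ w, loss (vote f w z.1) z.2 ∂ρ

/-- The event that the real valued classifier `h` classifies the example correctly. -/
def correctEvent {X : Type*} (h : X → ℝ) : Set (X × Label) := {z | loss (h z.1) z.2 = 0}

/-- The event that the real valued classifier `h` misclassifies the example. -/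
def errorEvent {X : Type*} (h : X → ℝ) : Set (X × Label) := {z | loss (h z.1) z.2 = 1}

/-- `b_D^ρ(h) = E_{(x,y) ∼ D} [ E_{h' ∼ ρ} ℓ(h'(x), y) | ℓ(h(x), y) = 0 ]`. -/
def bTerm {X : Type*} [MeasurableSpace X] {n : ℕ} (f : Fin n → X → Label)
    (D : Measure (X × Label)) (ρ : Measure (Fin n → ℝ)) (h : X → ℝ) : ℝ :=
  ∫ z, gibbsLoss f ρ z ∂(ProbabilityTheory.cond D (correctEvent h))

/-- `c_D^ρ(h) = E_{(x,y) ∼ D} [ E_{h' ∼ ρ} ℓ(h'(x), y) | ℓ(h(x), y) = 1 ]`. -/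
def cTerm {X : Type*} [MeasurableSpace X] {n : ℕ} (f : Fin n → X → Label)
    (D : Measure (X × Label)) (ρ : Measure (Fin n → ℝ)) (h : X → ℝ) : ℝ :=
  ∫ z, gibbsLoss f ρ z ∂(ProbabilityTheory.cond D (errorEvent h))

/-- The absolute difference of the sums of the two parts of the partition of `α` given by
the index set `S` and its complement. -/
def partitionGap {n : ℕ} (α : Fin n → ℝ) (S : Finset (Fin n)) : ℝ :=
  |∑ i ∈ S, α i - ∑ i ∈ Sᶜ, α i|

/-- The larger of the two sums of the partition given by `S` and its complement. -/
def partitionMax {n : ℕ} (α : Fin n → ℝ) (S : Finset (Fin n)) : ℝ :=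
  max (∑ i ∈ S, α i) (∑ i ∈ Sᶜ, α i)

/-- `S` and its complement solve the partition problem for `α`. -/
def IsOptimalPartition {n : ℕ} (α : Fin n → ℝ) (S : Finset (Fin n)) : Prop :=
  ∀ T : Finset (Fin n), partitionGap α S ≤ partitionGap α T

/-- The `ℓ¹` norm. -/
def l1Norm {n : ℕ} (α : Fin n → ℝ) : ℝ := ∑ i, |α i|

/-- The categorical distribution on the standard basis vectors: `e_i` has probability `α i`
(for `α` in the probability simplex). -/
def categorical {n : ℕ} (α : Fin n → ℝ) : Measure (Fin n → ℝ) :=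
  ∑ i, ENNReal.ofReal (α i) • Measure.dirac (Pi.single i (1 : ℝ))

/-- The Dirichlet distribution with parameters `α i > 0`: the law of `g / ∑ i, g i`, where the
coordinates `g i` are independent and `g i` is Gamma distributed with shape `α i` and rate `1`. -/
def dirichlet {n : ℕ} (α : Fin n → ℝ) : Measure (Fin n → ℝ) :=
  (Measure.pi fun i => gammaMeasure (α i) 1).map fun g i => g i / ∑ j, g j

/-- The Gaussian distribution with mean `α` and identity covariance matrix. -/
def gaussian {n : ℕ} (α : Fin n → ℝ) : Measure (Fin n → ℝ) :=
  (multivariateGaussian (WithLp.toLp 2 α) (1 : Matrix (Fin n) (Fin n) ℝ)).map WithLp.ofLp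

/-- The regularized incomplete beta function `I_x(a, b)` for `0 < x < 1` and `a, b ≥ 0` not both
zero. For `a, b > 0` it is `(∫ t in 0..x, t^(a-1) (1-t)^(b-1)) / B(a, b)`; at a zero parameter it
has the usual limit values `I_x(0, b) = 1` and `I_x(a, 0) = 0`. -/
def regIncBeta (x a b : ℝ) : ℝ :=
  if a = 0 then 1
  else if b = 0 then 0
  else (∫ t in (0 : ℝ)..x, t ^ (a - 1) * (1 - t) ^ (b - 1)) / ProbabilityTheory.beta a b

/-- The Gauss error function. -/
def erf (k : ℝ) : ℝ := 2 / Real.sqrt Real.pi * ∫ t in (0 : ℝ)..k, Real.exp (-t ^ 2)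

/-- `Φ(k) = (1 - Erf(k / √2)) / 2`, the upper tail of the standard Gaussian. -/
def gaussTail (k : ℝ) : ℝ := 1 / 2 * (1 - erf (k / Real.sqrt 2))

end MajorityVote

end

namespace MajorityVote

/-! ### Reduction to one example: the Gibbs loss as the `ρ`-measure of a half-space. -/

section General

variable {X : Type*} {n : ℕ}

/-! Fix an example and let `A` be the set of base classifiers that are right on it. The margin `y *
h_w(x)` is the weight of `A` minus the weight of `Aᶜ` (`label_mul_vote`), so the expected loss is `ρ
(lossSet A)`, and whether `h_α` errs depends only on comparing the two `α`-sums. Since `b` and `c`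
are conditional averages, it suffices to bound `ρ (lossSet A)` for every `A` on the relevant side
(`integral_gibbsLoss_cond_mem_Icc`).

Each posterior gives a closed form in the `α`-sums: the sum over `Aᶜ` (categorical), `I_{1/2}` of
the two sums (Dirichlet, through independent Gamma variables), and `Φ` of their difference over `√n`
(Gaussian). Each form is monotone as `α`-weight moves from one side to the other. An optimal
partition has the smallest gap and hence the smallest larger part, so it is the extreme case; in the
Gaussian case the `ℓ¹` norm bounds the gap from above. -/

lemma Label.eq_neg_one_or_eq_one (y : Label) : (y : ℝ) = -1 ∨ (y : ℝ) = 1 :=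
  y.2

lemma loss_eq_ite (v : ℝ) (y : Label) : loss v y = if (y : ℝ) * v ≤ 0 then 1 else 0 := by
  unfold loss
  rcases lt_trichotomy v 0 with h | h | h <;> rcases y.eq_neg_one_or_eq_one with hy | hy
  · simp [Real.sign_of_neg h, hy, h]
  · rw [Real.sign_of_neg h, hy, if_pos (by norm_num), if_pos (by linarith)]
  · simp [h, hy]
  · simp [h, hy]
  · rw [Real.sign_of_pos h, hy, if_pos (by norm_num), if_pos (by linarith)]
  · simp [Real.sign_of_pos h, hy, h]

/-- The set of base classifiers that classify the example correctly. -/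
noncomputable def agreeSet (f : Fin n → X → Label) (z : X × Label) : Finset (Fin n) :=
  open Classical in Finset.univ.filter fun i => f i z.1 = z.2

lemma label_mul_vote (f : Fin n → X → Label) (w : Fin n → ℝ) (z : X × Label) :
    (z.2 : ℝ) * vote f w z.1 = ∑ i ∈ agreeSet f z, w i - ∑ i ∈ (agreeSet f z)ᶜ, w i := by
  classical
  rw [vote, Finset.mul_sum, ← Finset.sum_add_sum_compl (agreeSet f z), sub_eq_add_neg,
    ← Finset.sum_neg_distrib]
  congr 1
  · refine Finset.sum_congr rfl fun i hi => ?_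
    have : f i z.1 = z.2 := by simpa [agreeSet] using hi
    rw [this]
    rcases z.2.eq_neg_one_or_eq_one with h | h <;> simp [h]
  · refine Finset.sum_congr rfl fun i hi => ?_
    have h1 : f i z.1 ≠ z.2 := by simpa [agreeSet] using hi
    have h2 : (f i z.1 : ℝ) ≠ z.2 := fun h => h1 (Subtype.ext h)
    rcases z.2.eq_neg_one_or_eq_one with h | h <;>
      rcases (f i z.1).eq_neg_one_or_eq_one with h' | h' <;> simp_all

lemma loss_vote (f : Fin n → X → Label) (w : Fin n → ℝ) (z : X × Label) :
    loss (vote f w z.1) z.2 =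
      if ∑ i ∈ agreeSet f z, w i ≤ ∑ i ∈ (agreeSet f z)ᶜ, w i then 1 else 0 := by
  simp only [loss_eq_ite, label_mul_vote, sub_nonpos]

lemma mem_correctEvent_vote (f : Fin n → X → Label) (w : Fin n → ℝ) (z : X × Label) :
    z ∈ correctEvent (vote f w) ↔
      ∑ i ∈ (agreeSet f z)ᶜ, w i < ∑ i ∈ agreeSet f z, w i := by
  simp [correctEvent, loss_vote]

lemma mem_errorEvent_vote (f : Fin n → X → Label) (w : Fin n → ℝ) (z : X × Label) :
    z ∈ errorEvent (vote f w) ↔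
      ∑ i ∈ agreeSet f z, w i ≤ ∑ i ∈ (agreeSet f z)ᶜ, w i := by
  simp [errorEvent, loss_vote]

/-- The weight vectors under which the classifiers in `A` do not outvote the others. -/
def lossSet (A : Finset (Fin n)) : Set (Fin n → ℝ) := {w | ∑ i ∈ A, w i ≤ ∑ i ∈ Aᶜ, w i}

lemma measurableSet_lossSet (A : Finset (Fin n)) : MeasurableSet (lossSet A) :=
  measurableSet_le (by fun_prop) (by fun_prop)

lemma gibbsLoss_eq (f : Fin n → X → Label) (ρ : Measure (Fin n → ℝ)) (z : X × Label) :
    gibbsLoss f ρ z = ρ.real (lossSet (agreeSet f z)) := by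
  rw [gibbsLoss, ← integral_indicator_one (measurableSet_lossSet _)]
  refine integral_congr_ae (.of_forall fun w => ?_)
  simp [loss_vote, lossSet, Set.indicator_apply]

variable [MeasurableSpace X]

lemma measurable_loss : Measurable fun p : ℝ × Label => loss p.1 p.2 := by
  simp only [loss_eq_ite]
  exact Measurable.ite (measurableSet_le (by fun_prop) measurable_const) measurable_const
    measurable_const

lemma measurable_loss_vote {f : Fin n → X → Label} (hf : ∀ i, Measurable (f i)) :
    Measurable fun p : (X × Label) × (Fin n → ℝ) => loss (vote f p.2 p.1.1) p.1.2 := by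
  refine measurable_loss.comp (Measurable.prodMk ?_ (by fun_prop))
  change Measurable fun p : (X × Label) × (Fin n → ℝ) => ∑ i, p.2 i * (f i p.1.1 : ℝ)
  exact Finset.measurable_sum _ fun i _ => by fun_prop

lemma measurable_loss_vote_left {f : Fin n → X → Label} (hf : ∀ i, Measurable (f i))
    (w : Fin n → ℝ) : Measurable fun z : X × Label => loss (vote f w z.1) z.2 :=
  (measurable_loss_vote hf).comp (measurable_id.prodMk measurable_const)

lemma measurableSet_correctEvent {f : Fin n → X → Label} (hf : ∀ i, Measurable (f i))
    (w : Fin n → ℝ) : MeasurableSet (correctEvent (vote f w)) :=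
  measurable_loss_vote_left hf w (measurableSet_singleton 0)

lemma measurableSet_errorEvent {f : Fin n → X → Label} (hf : ∀ i, Measurable (f i))
    (w : Fin n → ℝ) : MeasurableSet (errorEvent (vote f w)) :=
  measurable_loss_vote_left hf w (measurableSet_singleton 1)

/-- An average of values in a closed convex set stays in that set; integrability comes from the loss
being bounded by 1. -/
lemma integral_gibbsLoss_cond_mem_Icc {f : Fin n → X → Label} (hf : ∀ i, Measurable (f i))
    (D : Measure (X × Label)) [IsProbabilityMeasure D]
    (ρ : Measure (Fin n → ℝ)) [IsProbabilityMeasure ρ] {E : Set (X × Label)}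
    (hE : MeasurableSet E) (hE0 : D E ≠ 0) {lo hi : ℝ}
    (h : ∀ z ∈ E, ρ.real (lossSet (agreeSet f z)) ∈ Set.Icc lo hi) :
    ∫ z, gibbsLoss f ρ z ∂(ProbabilityTheory.cond D E) ∈ Set.Icc lo hi := by
  have := cond_isProbabilityMeasure hE0
  have hmem : ∀ᵐ z ∂(ProbabilityTheory.cond D E), gibbsLoss f ρ z ∈ Set.Icc lo hi := by
    filter_upwards [ae_cond_mem hE] with z hz
    rw [gibbsLoss_eq]
    exact h z hz
  have hmeas : AEStronglyMeasurable (gibbsLoss f ρ) (ProbabilityTheory.cond D E) :=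
    (measurable_loss_vote hf).stronglyMeasurable.integral_prod_right.aestronglyMeasurable
  have hint : Integrable (gibbsLoss f ρ) (ProbabilityTheory.cond D E) := by
    refine Integrable.of_bound hmeas 1 (.of_forall fun z => ?_)
    rw [gibbsLoss_eq, Real.norm_of_nonneg measureReal_nonneg]
    exact measureReal_le_one
  exact (convex_Icc lo hi).integral_mem isClosed_Icc hmem hint

end General

/-! ### Extremal properties of an optimal partition. -/

section Partition

variable {n : ℕ} {α : Fin n → ℝ} {S A : Finset (Fin n)}

/-- The larger part is half of total plus gap, and the total does not depend on the partition, so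
minimizing the gap minimizes the larger part. -/
lemma IsOptimalPartition.partitionMax_le (hS : IsOptimalPartition α S) (A : Finset (Fin n)) :
    partitionMax α S ≤ partitionMax α A := by
  have h := hS A
  have h1 := Finset.sum_add_sum_compl S α
  have h2 := Finset.sum_add_sum_compl A α
  unfold partitionGap at h
  unfold partitionMax
  rcases max_cases (∑ i ∈ S, α i) (∑ i ∈ Sᶜ, α i) with ⟨e, e'⟩ | ⟨e, e'⟩ <;>
    rcases max_cases (∑ i ∈ A, α i) (∑ i ∈ Aᶜ, α i) with ⟨d, d'⟩ | ⟨d, d'⟩ <;>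
    rw [e, d] <;> rcases abs_cases (∑ i ∈ S, α i - ∑ i ∈ Sᶜ, α i) with ⟨a, _⟩ | ⟨a, _⟩ <;>
    rcases abs_cases (∑ i ∈ A, α i - ∑ i ∈ Aᶜ, α i) with ⟨b, _⟩ | ⟨b, _⟩ <;> linarith

lemma partitionMax_of_lt (h : ∑ i ∈ Aᶜ, α i < ∑ i ∈ A, α i) :
    partitionMax α A = ∑ i ∈ A, α i := max_eq_left h.le

lemma partitionMax_of_le (h : ∑ i ∈ A, α i ≤ ∑ i ∈ Aᶜ, α i) :
    partitionMax α A = ∑ i ∈ Aᶜ, α i := max_eq_right h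

lemma partitionGap_of_lt (h : ∑ i ∈ Aᶜ, α i < ∑ i ∈ A, α i) :
    partitionGap α A = ∑ i ∈ A, α i - ∑ i ∈ Aᶜ, α i := abs_of_pos (sub_pos.2 h)

lemma partitionGap_of_le (h : ∑ i ∈ A, α i ≤ ∑ i ∈ Aᶜ, α i) :
    partitionGap α A = ∑ i ∈ Aᶜ, α i - ∑ i ∈ A, α i := by
  rw [partitionGap, abs_of_nonpos (sub_nonpos.2 h), neg_sub]

lemma partitionGap_le_l1Norm (α : Fin n → ℝ) (A : Finset (Fin n)) :
    partitionGap α A ≤ l1Norm α := by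
  rw [l1Norm, ← Finset.sum_add_sum_compl A]
  exact (abs_sub _ _).trans
    (add_le_add (Finset.abs_sum_le_sum_abs _ _) (Finset.abs_sum_le_sum_abs _ _))

end Partition

/-! ### Categorical posterior. -/

section Categorical

variable {n : ℕ} {α : Fin n → ℝ}

lemma isProbabilityMeasure_categorical (hα : α ∈ stdSimplex ℝ (Fin n)) :
    IsProbabilityMeasure (categorical α) := by
  constructor
  simp only [categorical, Measure.coe_finsetSum, Finset.sum_apply, Measure.smul_apply,
    measure_univ, smul_eq_mul, mul_one]
  rw [← ENNReal.ofReal_sum_of_nonneg fun i _ => hα.1 i, hα.2, ENNReal.ofReal_one]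

lemma categorical_real_lossSet (hα : α ∈ stdSimplex ℝ (Fin n)) (A : Finset (Fin n)) :
    (categorical α).real (lossSet A) = ∑ i ∈ Aᶜ, α i := by
  classical
  -- A vote by `e_i` alone loses exactly when classifier `i` is outside `A`.
  have key : ∀ i, (Pi.single i (1 : ℝ) : Fin n → ℝ) ∈ lossSet A ↔ i ∈ Aᶜ := by
    intro i
    by_cases hi : i ∈ A <;> simp [lossSet, hi]
  rw [measureReal_def, categorical]
  simp only [Measure.coe_finsetSum, Finset.sum_apply, Measure.smul_apply, smul_eq_mul,
    Measure.dirac_apply' _ (measurableSet_lossSet A), Set.indicator_apply, key, Pi.one_apply,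
    mul_ite, mul_one, mul_zero]
  rw [Finset.sum_ite_mem, Finset.univ_inter,
    ← ENNReal.ofReal_sum_of_nonneg fun i _ => hα.1 i, ENNReal.toReal_ofReal]
  exact Finset.sum_nonneg fun i _ => hα.1 i

end Categorical

/-! ### Gaussian posterior. -/

section Gaussian

lemma erf_neg (k : ℝ) : erf (-k) = -erf k := by
  have h := intervalIntegral.integral_comp_neg (a := 0) (b := k) fun t : ℝ => Real.exp (-t ^ 2)
  simp only [neg_sq, neg_zero] at h
  rw [erf, erf, h, intervalIntegral.integral_symm]
  ring

lemma gaussTail_neg (k : ℝ) : gaussTail (-k) = 1 - gaussTail k := by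
  rw [gaussTail, gaussTail, neg_div, erf_neg]
  ring

/-- Turns the error-function formula into a probability, which gives monotonicity at once. The
integral over `(0, k)` is half the Gaussian integral minus the tail beyond `k`, and scaling by `√2`
matches the exponents. -/
lemma gaussTail_eq_gaussianReal (k : ℝ) :
    gaussTail k = (gaussianReal 0 1).real (Set.Iic (-k)) := by
  set φ : ℝ → ℝ := fun x => Real.exp (-(1 / 2) * x ^ 2) with hφ
  have hint : Integrable φ := integrable_exp_neg_mul_sq (by norm_num)
  have hpdf : gaussianPDFReal 0 1 = fun x => (Real.sqrt (2 * Real.pi))⁻¹ * φ x := by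
    ext x
    simp only [gaussianPDFReal, hφ, NNReal.coe_one, mul_one, sub_zero]
    congr 2
    ring
  have h1 : (gaussianReal 0 1).real (Set.Iic (-k)) =
      (Real.sqrt (2 * Real.pi))⁻¹ * ∫ x in Set.Ioi k, φ x := by
    rw [measureReal_def, gaussianReal_apply_eq_integral 0 one_ne_zero,
      ENNReal.toReal_ofReal (integral_nonneg fun x => gaussianPDFReal_nonneg _ _ _), hpdf,
      integral_const_mul, ← neg_neg k, ← integral_comp_neg_Iic, neg_neg]
    simp [hφ]
  have h2 : ∫ x in (0 : ℝ)..k, φ x = (∫ x in Set.Ioi 0, φ x) - ∫ x in Set.Ioi k, φ x :=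
    (intervalIntegral.integral_Ioi_sub_Ioi' hint.integrableOn hint.integrableOn).symm
  have h3 : ∫ x in Set.Ioi (0 : ℝ), φ x = Real.sqrt (2 * Real.pi) / 2 := by
    rw [hφ, integral_gaussian_Ioi]
    congr 2
    ring
  have h4 : ∫ x in (0 : ℝ)..(k / Real.sqrt 2), Real.exp (-x ^ 2) =
      (Real.sqrt 2)⁻¹ * ∫ x in (0 : ℝ)..k, φ x := by
    have := intervalIntegral.integral_comp_div (a := 0) (b := k)
      (fun t : ℝ => Real.exp (-t ^ 2)) (c := Real.sqrt 2) (by positivity)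
    rw [zero_div, smul_eq_mul] at this
    rw [eq_inv_mul_iff_mul_eq₀ (by positivity), ← this]
    refine intervalIntegral.integral_congr fun x _ => ?_
    simp only [hφ, div_pow, Real.sq_sqrt zero_le_two]
    congr 1
    ring
  have hpi : 0 < Real.sqrt Real.pi := Real.sqrt_pos.2 Real.pi_pos
  rw [gaussTail, erf, h4, h1, h2, h3,
    Real.sqrt_mul zero_le_two]
  field_simp
  ring_nf

lemma gaussTail_antitone : Antitone gaussTail := fun a b h => by
  rw [gaussTail_eq_gaussianReal, gaussTail_eq_gaussianReal]
  exact measureReal_mono (Set.Iic_subset_Iic.2 (neg_le_neg h))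

lemma gaussianReal_real_Iic_zero (m : ℝ) {n : ℕ} (hn : 0 < n) :
    (gaussianReal m n).real (Set.Iic 0) = gaussTail (m / Real.sqrt n) := by
  have hs : 0 < Real.sqrt n := Real.sqrt_pos.2 (by exact_mod_cast hn)
  have h : gaussianReal m n =
      ((gaussianReal 0 1).map (Real.sqrt n * ·)).map (· + m) := by
    rw [gaussianReal_map_const_mul, gaussianReal_map_add_const]
    congr 1
    · simp
    · ext; simp
  rw [h, Measure.map_map (by fun_prop) (by fun_prop), gaussTail_eq_gaussianReal,
    map_measureReal_apply (by fun_prop) measurableSet_Iic]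
  congr 1
  ext x
  simp only [Set.mem_preimage, Function.comp_apply, Set.mem_Iic]
  rw [← neg_div, le_div_iff₀ hs]
  constructor <;> intro h <;> linarith

variable {n : ℕ}

instance isProbabilityMeasure_gaussian (α : Fin n → ℝ) : IsProbabilityMeasure (gaussian α) :=
  Measure.isProbabilityMeasure_map (by fun_prop)

/-- The characteristic function of the linear form `s` at `t` is that of the random vector at `t •
s`. -/
lemma gaussian_map_sum (α s : Fin n → ℝ) :
    (gaussian α).map (fun w => ∑ i, s i * w i) =
      gaussianReal (∑ i, s i * α i) (∑ i, s i ^ 2).toNNReal := by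
  have hm : Measurable fun w : Fin n → ℝ => ∑ i, s i * w i := by fun_prop
  have := Measure.isProbabilityMeasure_map (μ := gaussian α) hm.aemeasurable
  apply Measure.ext_of_charFun
  ext t
  have hm' : Measurable fun w : Fin n → ℝ =>
      Complex.exp (t * (∑ i, s i * w i : ℝ) * Complex.I) :=
    ((hm.complex_ofReal.const_mul _).mul_const _).cexp
  have hpos : 0 ≤ ∑ i, s i ^ 2 := Finset.sum_nonneg fun i _ => sq_nonneg _
  rw [charFun_gaussianReal, charFun_apply_real, integral_map hm.aemeasurable (by fun_prop),
    gaussian, integral_map (by fun_prop) hm'.aestronglyMeasurable]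
  have := charFun_multivariateGaussian (μ := WithLp.toLp 2 α)
    (S := (1 : Matrix (Fin n) (Fin n) ℝ)) Matrix.PosSemidef.one (WithLp.toLp 2 (t • s))
  rw [charFun_apply] at this
  convert this using 2
  · ext w
    simp only [PiLp.inner_apply, RCLike.inner_apply, conj_trivial, Pi.smul_apply, smul_eq_mul]
    push_cast
    rw [Finset.mul_sum]
    simp only [mul_assoc]
  · rw [Real.coe_toNNReal _ hpos]
    simp only [PiLp.inner_apply, RCLike.inner_apply, conj_trivial, Pi.smul_apply, smul_eq_mul,
      Matrix.one_mulVec, dotProduct]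
    push_cast
    rw [Finset.mul_sum, Finset.sum_mul, Finset.sum_mul, Finset.sum_mul]
    congr 2
    · ext i; ring
    · exact Finset.sum_congr rfl fun i _ => by ring

lemma gaussian_real_lossSet (hn : 0 < n) (α : Fin n → ℝ) (A : Finset (Fin n)) :
    (gaussian α).real (lossSet A) =
      gaussTail ((∑ i ∈ A, α i - ∑ i ∈ Aᶜ, α i) / Real.sqrt n) := by
  classical
  -- The margin is a linear form with coefficients `±1`, so its variance is `n` whatever `A` is.
  set s : Fin n → ℝ := fun i => if i ∈ A then 1 else -1 with hs
  have hsum : ∀ w : Fin n → ℝ, ∑ i, s i * w i = ∑ i ∈ A, w i - ∑ i ∈ Aᶜ, w i := by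
    intro w
    rw [← Finset.sum_add_sum_compl A, sub_eq_add_neg, ← Finset.sum_neg_distrib]
    congr 1 <;> refine Finset.sum_congr rfl fun i hi => ?_
    · simp [hs, hi]
    · simp [hs, Finset.mem_compl.1 hi]
  have hsq : (∑ i, s i ^ 2).toNNReal = n := by
    have : ∀ i, s i ^ 2 = 1 := fun i => by by_cases h : i ∈ A <;> simp [hs, h]
    simp [this]
  rw [← gaussianReal_real_Iic_zero _ hn, ← hsum, ← hsq, ← gaussian_map_sum,
    map_measureReal_apply (by fun_prop) measurableSet_Iic]
  congr 1
  ext w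
  simp only [lossSet, Set.mem_ofPred_eq, Set.mem_preimage, Set.mem_Iic, hsum, sub_nonpos]

end Gaussian

/-! ### Sums and comparison of independent Gamma variables. -/

section Gamma

variable {a b : ℝ}

/-- The substitution `y = u * t` in the convolution, with Jacobian `u`: the sum `u` and the
proportion `t` separate into a Gamma and a Beta density. -/
lemma gammaPDFReal_mul_comp_mul_eq (ha : 0 < a) (hb : 0 < b) {u t : ℝ} (hu : 0 < u)
    (ht0 : 0 < t) (ht1 : t < 1) :
    u * (gammaPDFReal a 1 (u * t) * gammaPDFReal b 1 (-(u * t) + u)) =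
      gammaPDFReal (a + b) 1 u * betaPDFReal a b t := by
  have h1 : 0 < 1 - t := sub_pos.2 ht1
  have e : -(u * t) + u = u * (1 - t) := by ring
  have hΓ := Real.Gamma_pos_of_pos (add_pos ha hb)
  have hΓa := Real.Gamma_pos_of_pos ha
  have hΓb := Real.Gamma_pos_of_pos hb
  rw [e, gammaPDFReal, gammaPDFReal, gammaPDFReal, betaPDFReal, if_pos (by positivity),
    if_pos (by positivity), if_pos hu.le, if_pos ⟨ht0, ht1⟩, beta,
    Real.mul_rpow hu.le ht0.le, Real.mul_rpow hu.le h1.le]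
  have h2 : u ^ (a + b - 1) = u ^ (a - 1) * u ^ (b - 1) * u := by
    rw [← Real.rpow_add hu, ← Real.rpow_add_one hu.ne']
    congr 1; ring
  have h3 : Real.exp (-(1 * u)) = Real.exp (-(1 * (u * t))) * Real.exp (-(1 * (u * (1 - t)))) := by
    rw [← Real.exp_add]
    congr 1; ring
  rw [h2, h3]
  simp only [Real.one_rpow]
  field_simp

/-- The substitution `x = y * t / (1 - t)`, that is `t = x / (x + y)`, has Jacobian `y / (1 - t) ^
2`. For fixed `t` the dependence on `y` is a Gamma density of rate `1 / (1 - t)`, which integrates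
to 1. -/
lemma gammaPDFReal_mul_comp_div_eq (ha : 0 < a) (hb : 0 < b) {y t : ℝ} (hy : 0 < y)
    (ht0 : 0 < t) (ht1 : t < 1) :
    y / (1 - t) ^ 2 * gammaPDFReal a 1 (y * t / (1 - t)) * gammaPDFReal b 1 y =
      betaPDFReal a b t * gammaPDFReal (a + b) (1 / (1 - t)) y := by
  have h1 : 0 < 1 - t := sub_pos.2 ht1
  have hΓ := Real.Gamma_pos_of_pos (add_pos ha hb)
  have hΓa := Real.Gamma_pos_of_pos ha
  have hΓb := Real.Gamma_pos_of_pos hb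
  rw [gammaPDFReal, gammaPDFReal, gammaPDFReal, betaPDFReal, if_pos (by positivity),
    if_pos hy.le, if_pos hy.le, if_pos ⟨ht0, ht1⟩, beta,
    Real.div_rpow (by positivity) h1.le, Real.mul_rpow hy.le ht0.le,
    Real.div_rpow zero_le_one h1.le]
  have h2 : y ^ (a + b - 1) = y ^ (a - 1) * y ^ (b - 1) * y := by
    rw [← Real.rpow_add hy, ← Real.rpow_add_one hy.ne']
    congr 1; ring
  have h4 : (1 - t) ^ (a + b) = (1 - t) ^ (a - 1) * (1 - t) ^ (b - 1) * (1 - t) ^ 2 := by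
    rw [← Real.rpow_add h1, ← Real.rpow_add_natCast h1.ne']
    congr 1; push_cast; ring
  have h3 : Real.exp (-(1 / (1 - t) * y)) =
      Real.exp (-(1 * (y * t / (1 - t)))) * Real.exp (-(1 * y)) := by
    rw [← Real.exp_add]
    congr 1; field_simp; ring
  rw [h2, h3, h4]
  simp only [Real.one_rpow]
  field_simp

lemma measurable_gammaPDF (a r : ℝ) : Measurable (gammaPDF a r) :=
  (measurable_gammaPDFReal a r).ennreal_ofReal

lemma gammaPDF_ne_top {r x : ℝ} : gammaPDF a r x ≠ ⊤ := ENNReal.ofReal_ne_top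

lemma betaPDF_ne_top {x : ℝ} : betaPDF a b x ≠ ⊤ := ENNReal.ofReal_ne_top

lemma setLIntegral_betaPDF_Ioo (ha : 0 < a) (hb : 0 < b) :
    ∫⁻ t in Set.Ioo (0 : ℝ) 1, betaPDF a b t = 1 := by
  rw [← lintegral_betaPDF_eq_one ha hb]
  refine setLIntegral_eq_of_support_subset ?_
  intro t ht
  by_contra h
  rw [Set.mem_Ioo, not_and_or, not_lt, not_lt] at h
  exact ht (h.elim betaPDF_eq_zero_of_nonpos betaPDF_eq_zero_of_one_le)

/-- The point `u = 0` is a true exception: there the integrand lives on a null set, while `gammaPDF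
(a + b) 1 0` is nonzero when `a + b = 1`. -/
lemma lconvolution_gammaPDF (ha : 0 < a) (hb : 0 < b) {u : ℝ} (hu : u ≠ 0) :
    lconvolution (gammaPDF a 1) (gammaPDF b 1) volume u = gammaPDF (a + b) 1 u := by
  rw [lconvolution_def]
  rcases hu.lt_or_gt with hu | hu
  · rw [gammaPDF_of_neg hu]
    refine (lintegral_congr fun y => ?_).trans lintegral_zero
    rcases lt_or_ge y 0 with hy | hy
    · rw [gammaPDF_of_neg hy, zero_mul]
    · rw [gammaPDF_of_neg (x := -y + u) (by linarith), mul_zero]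
  · have himg : (fun t : ℝ => u * t) '' Set.Ioo 0 1 = Set.Ioo 0 u := by
      rw [Set.image_mul_left_Ioo hu, mul_zero, mul_one]
    have hsupp : ∫⁻ y, gammaPDF a 1 y * gammaPDF b 1 (-y + u) =
        ∫⁻ y in Set.Icc 0 u, gammaPDF a 1 y * gammaPDF b 1 (-y + u) := by
      refine (setLIntegral_eq_of_support_subset fun y hy => ?_).symm
      by_contra h
      rw [Set.mem_Icc, not_and_or, not_le, not_le] at h
      rcases h with h | h
      · exact hy (by simp only [gammaPDF_of_neg h, zero_mul])
      · exact hy (by simp only [gammaPDF_of_neg (x := -y + u) (by linarith), mul_zero])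
    rw [hsupp, ← setLIntegral_congr Ioo_ae_eq_Icc, ← himg,
      lintegral_image_eq_lintegral_abs_deriv_mul measurableSet_Ioo (f' := fun _ => u)
        (fun t _ => by simpa using ((hasDerivAt_id t).const_mul u).hasDerivWithinAt)
        (fun s _ t _ h => mul_left_cancel₀ hu.ne' h)]
    rw [setLIntegral_congr_fun (g := fun t => gammaPDF (a + b) 1 u * betaPDF a b t)
      measurableSet_Ioo, lintegral_const_mul' _ _ gammaPDF_ne_top,
      setLIntegral_betaPDF_Ioo ha hb, mul_one]
    intro t ht
    have h1 := gammaPDFReal_nonneg ha one_pos (u * t)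
    simp only [gammaPDF, betaPDF]
    rw [abs_of_pos hu, ← ENNReal.ofReal_mul h1, ← ENNReal.ofReal_mul hu.le,
      gammaPDFReal_mul_comp_mul_eq ha hb hu ht.1 ht.2,
      ENNReal.ofReal_mul (gammaPDFReal_nonneg (add_pos ha hb) one_pos u)]

/-- Gamma distributions with the same rate convolve by adding their shapes. -/
lemma gammaMeasure_conv_gammaMeasure (ha : 0 < a) (hb : 0 < b) :
    (gammaMeasure a 1).conv (gammaMeasure b 1) = gammaMeasure (a + b) 1 := by
  rw [gammaMeasure, gammaMeasure, gammaMeasure,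
    conv_withDensity_eq_lconvolution (measurable_gammaPDF a 1) (measurable_gammaPDF b 1)]
  refine withDensity_congr_ae ?_
  filter_upwards [compl_mem_ae_iff.2 (measure_singleton (0 : ℝ))] with u hu
  exact lconvolution_gammaPDF ha hb hu

lemma ae_gammaMeasure_pos (a r : ℝ) : ∀ᵐ x ∂(gammaMeasure a r), 0 < x := by
  rw [gammaMeasure, ae_withDensity_iff (measurable_gammaPDF a r)]
  filter_upwards [compl_mem_ae_iff.2 (measure_singleton (0 : ℝ))] with x hx h
  refine lt_of_le_of_ne ?_ (Ne.symm hx)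
  by_contra h'
  exact h (gammaPDF_of_neg (not_le.1 h'))

/-- In the variable `t = x / (x + y)` the condition `x ≤ y` becomes `t ≤ 1 / 2`, a range independent
of `y`, so that Tonelli applies afterwards. -/
lemma setLIntegral_gammaPDF_Iic (a : ℝ) {y : ℝ} (hy : 0 < y) :
    ∫⁻ x in Set.Iic y, gammaPDF a 1 x =
      ∫⁻ t in Set.Ioc (0 : ℝ) (1 / 2),
        ENNReal.ofReal (y / (1 - t) ^ 2) * gammaPDF a 1 (y * t / (1 - t)) := by
  have himg : (fun t : ℝ => y * t / (1 - t)) '' Set.Ioc 0 (1 / 2) = Set.Ioc 0 y := by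
    ext x
    simp only [Set.mem_image, Set.mem_Ioc]
    constructor
    · rintro ⟨t, ⟨h0, h1⟩, rfl⟩
      have : 0 < 1 - t := by linarith
      refine ⟨by positivity, ?_⟩
      rw [div_le_iff₀ this]
      nlinarith
    · rintro ⟨h0, h1⟩
      have : 0 < x + y := by linarith
      refine ⟨x / (x + y), ⟨by positivity, ?_⟩, ?_⟩
      · rw [div_le_div_iff₀ this two_pos]; linarith
      · have h2 : 1 - x / (x + y) = y / (x + y) := by field_simp; ring
        rw [h2]; field_simp
  have hIoc : ∫⁻ x in Set.Iic y, gammaPDF a 1 x = ∫⁻ x in Set.Ioc 0 y, gammaPDF a 1 x := by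
    rw [lintegral_Iic_eq_lintegral_Iio_add_Icc _ hy.le, lintegral_gammaPDF_of_nonpos le_rfl,
      zero_add, setLIntegral_congr Ioc_ae_eq_Icc]
  rw [hIoc, ← himg, lintegral_image_eq_lintegral_abs_deriv_mul measurableSet_Ioc
    (f' := fun t => y / (1 - t) ^ 2)]
  · refine setLIntegral_congr_fun measurableSet_Ioc fun t ht => ?_
    rw [abs_of_nonneg (by positivity)]
  · intro t ht
    have h1 : 1 - t ≠ 0 := by linarith [ht.2]
    have := ((hasDerivAt_id t).const_mul y).div ((hasDerivAt_id t).const_sub 1) h1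
    refine (this.congr_deriv ?_).hasDerivWithinAt
    simp only [id]
    congr 1
    ring
  · intro s hs t ht h
    have h1 : 1 - t ≠ 0 := by linarith [ht.2]
    have h2 : 1 - s ≠ 0 := by linarith [hs.2]
    rw [div_eq_div_iff h2 h1] at h
    have : y * (s - t) = 0 := by linarith
    rcases mul_eq_zero.1 this with h | h
    · exact absurd h hy.ne'
    · linarith

/-- If `x` and `y` are independent Gamma variables with shapes `a` and `b`, then `x ≤ y` has the
probability that a Beta variable with parameters `a` and `b` is at most `1 / 2`. -/
lemma prod_gammaMeasure_le (ha : 0 < a) (hb : 0 < b) :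
    ((gammaMeasure a 1).prod (gammaMeasure b 1)) {p | p.1 ≤ p.2} =
      ∫⁻ t in Set.Ioc (0 : ℝ) (1 / 2), betaPDF a b t := by
  have := isProbabilityMeasure_gammaMeasure ha one_pos
  have := isProbabilityMeasure_gammaMeasure hb one_pos
  have hIic : ∀ y, (fun x : ℝ => (x, y)) ⁻¹' {p | p.1 ≤ p.2} = Set.Iic y := fun y => rfl
  have hIoi : (gammaMeasure b 1) = (gammaMeasure b 1).restrict (Set.Ioi 0) :=
    (Measure.restrict_eq_self_of_ae_mem (ae_gammaMeasure_pos b 1)).symm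
  have hm : Measurable fun p : ℝ × ℝ =>
      gammaPDF b 1 p.1 * (ENNReal.ofReal (p.1 / (1 - p.2) ^ 2) *
        gammaPDF a 1 (p.1 * p.2 / (1 - p.2))) :=
    ((measurable_gammaPDF b 1).comp measurable_fst).mul
      ((Measurable.ennreal_ofReal (by fun_prop)).mul
        ((measurable_gammaPDF a 1).comp (by fun_prop)))
  rw [Measure.prod_apply_symm (measurableSet_le measurable_fst measurable_snd)]
  simp only [hIic]
  rw [hIoi, setLIntegral_congr_fun (g := fun y => ∫⁻ t in Set.Ioc (0 : ℝ) (1 / 2),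
    ENNReal.ofReal (y / (1 - t) ^ 2) * gammaPDF a 1 (y * t / (1 - t))) measurableSet_Ioi
    (fun y hy => by
      rw [gammaMeasure, withDensity_apply _ measurableSet_Iic, setLIntegral_gammaPDF_Iic a hy])]
  rw [gammaMeasure, setLIntegral_withDensity_eq_setLIntegral_mul _ (measurable_gammaPDF b 1) ?_
    measurableSet_Ioi]
  · simp only [Pi.mul_apply]
    simp_rw [← lintegral_const_mul' _ _ gammaPDF_ne_top]
    -- With `y` now innermost, its Gamma density integrates to 1 and only the Beta density in `t`
    -- remains.
    rw [lintegral_lintegral_swap hm.aemeasurable]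
    refine setLIntegral_congr_fun measurableSet_Ioc fun t ht => ?_
    have ht1 : t < 1 := by linarith [ht.2]
    have hr : 0 < 1 / (1 - t) := by
      have : 0 < 1 - t := by linarith
      positivity
    have hone : ∫⁻ y in Set.Ioi 0, gammaPDF (a + b) (1 / (1 - t)) y = 1 := by
      rw [← lintegral_gammaPDF_eq_one (add_pos ha hb) hr,
        setLIntegral_congr Ioi_ae_eq_Ici]
      refine setLIntegral_eq_of_support_subset fun y hy => ?_
      by_contra h
      exact hy (gammaPDF_of_neg (not_le.1 h))
    rw [setLIntegral_congr_fun (g := fun y => betaPDF a b t * gammaPDF (a + b) (1 / (1 - t)) y)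
      measurableSet_Ioi, lintegral_const_mul' _ _ betaPDF_ne_top, hone, mul_one]
    intro y hy
    simp only [gammaPDF, betaPDF]
    rw [← ENNReal.ofReal_mul (betaPDFReal_pos ht.1 ht1 ha hb).le,
      ← gammaPDFReal_mul_comp_div_eq ha hb hy ht.1 ht1, mul_comm,
      ENNReal.ofReal_mul (mul_nonneg (div_nonneg (le_of_lt hy) (sq_nonneg _))
        (gammaPDFReal_nonneg ha one_pos _)),
      ENNReal.ofReal_mul (div_nonneg (le_of_lt hy) (sq_nonneg _))]
  · refine Measurable.lintegral_prod_right' (f := fun p : ℝ × ℝ =>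
      ENNReal.ofReal (p.1 / (1 - p.2) ^ 2) * gammaPDF a 1 (p.1 * p.2 / (1 - p.2))) ?_
    exact (Measurable.ennreal_ofReal (by fun_prop)).mul
        ((measurable_gammaPDF a 1).comp (by fun_prop))

lemma regIncBeta_half_eq (ha : 0 < a) (hb : 0 < b) :
    regIncBeta (1 / 2) a b = (∫⁻ t in Set.Ioc (0 : ℝ) (1 / 2), betaPDF a b t).toReal := by
  have h : ∀ t ∈ Set.Ioc (0 : ℝ) (1 / 2),
      (betaPDF a b t).toReal = (beta a b)⁻¹ * (t ^ (a - 1) * (1 - t) ^ (b - 1)) := by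
    intro t ht
    have ht1 : t < 1 := by linarith [ht.2]
    rw [betaPDF, ENNReal.toReal_ofReal (betaPDFReal_pos ht.1 ht1 ha hb).le, betaPDFReal,
      if_pos ⟨ht.1, ht1⟩, one_div, mul_assoc]
  rw [← integral_toReal (f := betaPDF a b)
    (measurable_betaPDFReal a b).ennreal_ofReal.aemeasurable
    (.of_forall fun t => ENNReal.ofReal_lt_top), setIntegral_congr_fun measurableSet_Ioc h,
    integral_const_mul, regIncBeta, if_neg ha.ne', if_neg hb.ne',
    intervalIntegral.integral_of_le (by norm_num), div_eq_inv_mul]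

end Gamma

/-! ### Dirichlet posterior and monotonicity of `I_{1/2}`. -/

section Dirichlet

variable {n : ℕ} {α : Fin n → ℝ}

/-- The joint law of independent Gamma variables with shapes `α i` and rate `1`. -/
noncomputable abbrev gammaPi (α : Fin n → ℝ) : Measure (Fin n → ℝ) :=
  Measure.pi fun i => gammaMeasure (α i) 1

instance sigmaFinite_gammaMeasure (a r : ℝ) : SigmaFinite (gammaMeasure a r) :=
  SigmaFinite.withDensity_of_ne_top (.of_forall fun _ => gammaPDF_ne_top)

lemma isProbabilityMeasure_gammaPi (hα : ∀ i, 0 < α i) : IsProbabilityMeasure (gammaPi α) := by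
  have := fun i => isProbabilityMeasure_gammaMeasure (hα i) one_pos
  infer_instance

lemma iIndepFun_gammaPi (hα : ∀ i, 0 < α i) :
    iIndepFun (fun i (g : Fin n → ℝ) => g i) (gammaPi α) := by
  have := fun i => isProbabilityMeasure_gammaMeasure (hα i) one_pos
  exact iIndepFun_pi (X := fun _ x => x) fun _ => aemeasurable_id

/-- An empty sum has law `dirac 0`, which is not a Gamma law; hence the nonemptiness. -/
lemma gammaPi_map_sum (hα : ∀ i, 0 < α i) {A : Finset (Fin n)} (hA : A.Nonempty) :
    (gammaPi α).map (fun g => ∑ i ∈ A, g i) = gammaMeasure (∑ i ∈ A, α i) 1 := by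
  have := fun i => isProbabilityMeasure_gammaMeasure (hα i) one_pos
  have heval : ∀ i, (gammaPi α).map (fun g => g i) = gammaMeasure (α i) 1 := fun i =>
    (measurePreserving_eval (fun i => gammaMeasure (α i) 1) i).map_eq
  induction hA using Finset.Nonempty.cons_induction with
  | singleton i => simp [heval]
  | cons i s his hs ih =>
    have hind := (iIndepFun_gammaPi hα).indepFun_finsetSum_of_notMem
      (fun i => measurable_pi_apply i) his
    have hfun : (fun g : Fin n → ℝ => ∑ j ∈ Finset.cons i s his, g j) =
        (∑ j ∈ s, fun g : Fin n → ℝ => g j) + fun g => g i := by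
      ext g
      rw [Finset.sum_cons, add_comm, Pi.add_apply, Finset.sum_apply]
    have hfun' : (∑ j ∈ s, fun g : Fin n → ℝ => g j) = fun g => ∑ j ∈ s, g j := by
      ext g
      simp
    rw [hfun, hind.map_add_eq_map_conv_map (by rw [hfun']; fun_prop) (by fun_prop), heval,
      hfun', ih, gammaMeasure_conv_gammaMeasure (Finset.sum_pos (fun j _ => hα j) hs) (hα i),
      Finset.sum_cons, add_comm]

lemma ae_gammaPi_pos (α : Fin n → ℝ) : ∀ᵐ g ∂(gammaPi α), ∀ i, 0 < g i :=
  ae_all_iff.2 fun i => (Measure.quasiMeasurePreserving_eval _ i).ae (ae_gammaMeasure_pos (α i) 1)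

lemma gammaPi_real_lossSet_of_nonempty (hα : ∀ i, 0 < α i) {A : Finset (Fin n)}
    (hA : A.Nonempty) (hAc : Aᶜ.Nonempty) :
    (gammaPi α).real (lossSet A) =
      regIncBeta (1 / 2) (∑ i ∈ A, α i) (∑ i ∈ Aᶜ, α i) := by
  have := isProbabilityMeasure_gammaPi hα
  have hm : ∀ B : Finset (Fin n), Measurable fun g : Fin n → ℝ => ∑ i ∈ B, g i :=
    fun B => by fun_prop
  have hind : IndepFun (fun g : Fin n → ℝ => ∑ i ∈ A, g i) (fun g => ∑ i ∈ Aᶜ, g i)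
      (gammaPi α) := by
    have h := (iIndepFun_gammaPi hα).indepFun_finset A Aᶜ disjoint_compl_right
      fun i => measurable_pi_apply i
    have h' := h.comp (φ := fun x : A → ℝ => ∑ i, x i)
      (ψ := fun x : (Aᶜ : Finset (Fin n)) → ℝ => ∑ i, x i) (by fun_prop) (by fun_prop)
    convert h' using 1 <;> ext g
    · exact (Finset.sum_coe_sort A g).symm
    · exact (Finset.sum_coe_sort Aᶜ g).symm
  have hprod := hind.map_prod_eq_prod_map_map (hm A).aemeasurable (hm Aᶜ).aemeasurable
  rw [gammaPi_map_sum hα hA, gammaPi_map_sum hα hAc] at hprod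
  rw [regIncBeta_half_eq (Finset.sum_pos (fun j _ => hα j) hA)
    (Finset.sum_pos (fun j _ => hα j) hAc), ← prod_gammaMeasure_le
    (Finset.sum_pos (fun j _ => hα j) hA) (Finset.sum_pos (fun j _ => hα j) hAc), ← hprod,
    Measure.map_apply ((hm A).prodMk (hm Aᶜ)) (measurableSet_le measurable_fst measurable_snd)]
  rfl

/-- For `A` empty or full the event is almost sure or null by positivity, which agrees with the
limit values built into `regIncBeta`. -/
lemma gammaPi_real_lossSet (hn : 0 < n) (hα : ∀ i, 0 < α i) (A : Finset (Fin n)) :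
    (gammaPi α).real (lossSet A) =
      regIncBeta (1 / 2) (∑ i ∈ A, α i) (∑ i ∈ Aᶜ, α i) := by
  have := isProbabilityMeasure_gammaPi hα
  have : Nonempty (Fin n) := ⟨⟨0, hn⟩⟩
  rcases A.eq_empty_or_nonempty with rfl | hA
  · have h : lossSet (∅ : Finset (Fin n)) =ᵐ[gammaPi α] Set.univ := by
      rw [Filter.eventuallyEq_univ]
      filter_upwards [ae_gammaPi_pos α] with g hg
      change ∑ i ∈ ∅, g i ≤ ∑ i ∈ ∅ᶜ, g i
      exact Finset.sum_empty.trans_le (Finset.sum_nonneg fun i _ => (hg i).le)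
    rw [measureReal_congr h]
    simp [regIncBeta]
  rcases Aᶜ.eq_empty_or_nonempty with h0 | hAc
  · have hA' : A = Finset.univ := Finset.compl_eq_empty_iff A |>.1 h0
    have h : lossSet A =ᵐ[gammaPi α] (∅ : Set (Fin n → ℝ)) := by
      rw [ae_eq_empty, measure_eq_zero_iff_ae_notMem]
      filter_upwards [ae_gammaPi_pos α] with g hg
      simp only [lossSet, h0, Finset.sum_empty, Set.mem_ofPred_eq, not_le]
      exact Finset.sum_pos (fun i _ => hg i) hA
    have hpos : ∑ i ∈ A, α i ≠ 0 := (Finset.sum_pos (fun i _ => hα i) hA).ne'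
    rw [measureReal_congr h, h0, regIncBeta, if_neg hpos]
    simp
  · exact gammaPi_real_lossSet_of_nonempty hα hA hAc

lemma regIncBeta_half_mem_Icc {a b : ℝ} (ha : 0 < a) (hb : 0 < b) :
    regIncBeta (1 / 2) a b ∈ Set.Icc 0 1 := by
  have hα : ∀ i, 0 < ![a, b] i := by simp [Fin.forall_fin_two, ha, hb]
  have := isProbabilityMeasure_gammaPi hα
  have h := gammaPi_real_lossSet two_pos hα {0}
  have hc : ({0} : Finset (Fin 2))ᶜ = {1} := by decide
  simp only [hc, Finset.sum_singleton, Matrix.cons_val_zero, Matrix.cons_val_one] at h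
  rw [← h]
  exact ⟨measureReal_nonneg, measureReal_le_one⟩

/-- Coupling: for independent Gamma variables `x`, `v`, `y` of shapes `a`, `d`, `b`, the event `x +
v ≤ y` implies `x ≤ v + y` because `v > 0`. -/
lemma regIncBeta_half_add_le {a d b : ℝ} (ha : 0 < a) (hd : 0 < d) (hb : 0 < b) :
    regIncBeta (1 / 2) (a + d) b ≤ regIncBeta (1 / 2) a (d + b) := by
  set β : Fin 3 → ℝ := ![a, d, b] with hβ
  have hα : ∀ i, 0 < β i := by
    intro i; fin_cases i <;> assumption
  have := isProbabilityMeasure_gammaPi hα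
  have h1 := gammaPi_real_lossSet three_pos hα {0}
  have h2 := gammaPi_real_lossSet three_pos hα {0, 1}
  have hc1 : ({0} : Finset (Fin 3))ᶜ = {1, 2} := by decide
  have hc2 : ({0, 1} : Finset (Fin 3))ᶜ = {2} := by decide
  have e1 : ∀ g : Fin 3 → ℝ, ∑ i ∈ {1, 2}, g i = g 1 + g 2 :=
    fun g => Finset.sum_pair (by decide)
  have e2 : ∀ g : Fin 3 → ℝ, ∑ i ∈ {0, 1}, g i = g 0 + g 1 :=
    fun g => Finset.sum_pair (by decide)
  have h1' : regIncBeta (1 / 2) a (d + b) = (gammaPi β).real (lossSet {0}) := by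
    rw [h1, hc1, e1, Finset.sum_singleton]; rfl
  have h2' : regIncBeta (1 / 2) (a + d) b = (gammaPi β).real (lossSet {0, 1}) := by
    rw [h2, hc2, e2, Finset.sum_singleton]; rfl
  rw [h1', h2']
  refine ENNReal.toReal_mono (measure_ne_top _ _) (measure_mono_ae ?_)
  filter_upwards [ae_gammaPi_pos β] with g hg hg'
  have hg1 := hg 1
  change ∑ i ∈ {0, 1}, g i ≤ ∑ i ∈ ({0, 1} : Finset (Fin 3))ᶜ, g i at hg'
  change ∑ i ∈ {0}, g i ≤ ∑ i ∈ ({0} : Finset (Fin 3))ᶜ, g i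
  rw [hc2, e2, Finset.sum_singleton] at hg'
  rw [hc1, e1, Finset.sum_singleton]
  linarith

/-- Moving mass `a' - a` from the second parameter to the first lowers `I_{1/2}`; the zero
parameters, where no Gamma law is available, are checked by hand. -/
lemma regIncBeta_half_le {a b a' b' : ℝ} (ha : 0 ≤ a) (haa' : a ≤ a') (hb' : 0 ≤ b')
    (hab : a + b = a' + b') (hpos : 0 < a + b) :
    regIncBeta (1 / 2) a' b' ≤ regIncBeta (1 / 2) a b := by
  rcases haa'.eq_or_lt with rfl | hlt
  · obtain rfl : b = b' := by linarith
    exact le_rfl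
  rcases ha.eq_or_lt with rfl | ha
  · rcases hb'.eq_or_lt with rfl | hb'
    · simp [regIncBeta, hlt.ne']
    · simpa [regIncBeta] using (regIncBeta_half_mem_Icc hlt hb').2
  rcases hb'.eq_or_lt with rfl | hb'
  · have h := (regIncBeta_half_mem_Icc ha (b := b) (by linarith)).1
    rwa [regIncBeta, if_neg (by linarith : a' ≠ 0), if_pos rfl]
  have h := regIncBeta_half_add_le ha (sub_pos.2 hlt) hb'
  rwa [show a + (a' - a) = a' by ring, show a' - a + b' = b by linarith] at h

lemma measurable_div_sum : Measurable fun (g : Fin n → ℝ) (i : Fin n) => g i / ∑ j, g j := by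
  fun_prop

lemma isProbabilityMeasure_dirichlet (hα : ∀ i, 0 < α i) :
    IsProbabilityMeasure (dirichlet α) := by
  have := isProbabilityMeasure_gammaPi hα
  exact Measure.isProbabilityMeasure_map measurable_div_sum.aemeasurable

/-- `lossSet A` is invariant under positive scaling, so normalizing the Gamma vector changes
nothing. -/
lemma dirichlet_real_lossSet (hn : 0 < n) (hα : ∀ i, 0 < α i) (A : Finset (Fin n)) :
    (dirichlet α).real (lossSet A) =
      regIncBeta (1 / 2) (∑ i ∈ A, α i) (∑ i ∈ Aᶜ, α i) := by
  have : Nonempty (Fin n) := ⟨⟨0, hn⟩⟩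
  rw [← gammaPi_real_lossSet hn hα, dirichlet,
    map_measureReal_apply measurable_div_sum (measurableSet_lossSet A)]
  refine measureReal_congr ?_
  filter_upwards [ae_gammaPi_pos α] with g hg
  have hpos : 0 < ∑ j, g j := Finset.sum_pos (fun i _ => hg i) Finset.univ_nonempty
  refine propext ?_
  change ∑ i ∈ A, g i / ∑ j, g j ≤ ∑ i ∈ Aᶜ, g i / ∑ j, g j ↔ ∑ i ∈ A, g i ≤ ∑ i ∈ Aᶜ, g i
  rw [← Finset.sum_div, ← Finset.sum_div, div_le_div_iff_of_pos_right hpos]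

end Dirichlet

end MajorityVote

/-! ### Assembly of the three posteriors. -/

theorem mainTheorem3 {X : Type*} [MeasurableSpace X] {n : ℕ} (hn : 0 < n)
    (f : Fin n → X → MajorityVote.Label) (hf : ∀ i, Measurable (f i))
    (D : MeasureTheory.Measure (X × MajorityVote.Label)) [MeasureTheory.IsProbabilityMeasure D]
    (α : Fin n → ℝ) (S : Finset (Fin n)) (hS : MajorityVote.IsOptimalPartition α S) :
    -- Categorical posterior
    (α ∈ stdSimplex ℝ (Fin n) →
      (D (MajorityVote.correctEvent (MajorityVote.vote f α)) ≠ 0 →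
        0 ≤ MajorityVote.bTerm f D (MajorityVote.categorical α) (MajorityVote.vote f α) ∧
        MajorityVote.bTerm f D (MajorityVote.categorical α) (MajorityVote.vote f α)
          ≤ 1 - MajorityVote.partitionMax α S) ∧
      (D (MajorityVote.errorEvent (MajorityVote.vote f α)) ≠ 0 →
        MajorityVote.partitionMax α S
          ≤ MajorityVote.cTerm f D (MajorityVote.categorical α) (MajorityVote.vote f α) ∧
        MajorityVote.cTerm f D (MajorityVote.categorical α) (MajorityVote.vote f α) ≤ 1)) ∧
    -- Dirichlet posterior
    ((∀ i, 0 < α i) →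
      (D (MajorityVote.correctEvent (MajorityVote.vote f α)) ≠ 0 →
        0 ≤ MajorityVote.bTerm f D (MajorityVote.dirichlet α) (MajorityVote.vote f α) ∧
        MajorityVote.bTerm f D (MajorityVote.dirichlet α) (MajorityVote.vote f α)
          ≤ MajorityVote.regIncBeta (1 / 2) (MajorityVote.partitionMax α S)
              (MajorityVote.l1Norm α - MajorityVote.partitionMax α S)) ∧
      (D (MajorityVote.errorEvent (MajorityVote.vote f α)) ≠ 0 →
        MajorityVote.regIncBeta (1 / 2) (MajorityVote.l1Norm α - MajorityVote.partitionMax α S)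
            (MajorityVote.partitionMax α S)
          ≤ MajorityVote.cTerm f D (MajorityVote.dirichlet α) (MajorityVote.vote f α) ∧
        MajorityVote.cTerm f D (MajorityVote.dirichlet α) (MajorityVote.vote f α) ≤ 1)) ∧
    -- Unit-variance Gaussian posterior
    ((D (MajorityVote.correctEvent (MajorityVote.vote f α)) ≠ 0 →
        MajorityVote.gaussTail (MajorityVote.l1Norm α / Real.sqrt n)
          ≤ MajorityVote.bTerm f D (MajorityVote.gaussian α) (MajorityVote.vote f α) ∧
        MajorityVote.bTerm f D (MajorityVote.gaussian α) (MajorityVote.vote f α)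
          ≤ MajorityVote.gaussTail (MajorityVote.partitionGap α S / Real.sqrt n)) ∧
      (D (MajorityVote.errorEvent (MajorityVote.vote f α)) ≠ 0 →
        1 - MajorityVote.gaussTail (MajorityVote.partitionGap α S / Real.sqrt n)
          ≤ MajorityVote.cTerm f D (MajorityVote.gaussian α) (MajorityVote.vote f α) ∧
        MajorityVote.cTerm f D (MajorityVote.gaussian α) (MajorityVote.vote f α)
          ≤ 1 - MajorityVote.gaussTail (MajorityVote.l1Norm α / Real.sqrt n))) := by
  have hc := MajorityVote.measurableSet_correctEvent hf α
  have he := MajorityVote.measurableSet_errorEvent hf α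
  have hsum := fun A : Finset (Fin n) => Finset.sum_add_sum_compl A α
  refine ⟨fun hα => ?_, fun hα => ?_, fun h0 => ?_, fun h0 => ?_⟩
  · have := MajorityVote.isProbabilityMeasure_categorical hα
    refine ⟨fun h0 => ?_, fun h0 => ?_⟩
    · refine MajorityVote.integral_gibbsLoss_cond_mem_Icc hf D _ hc h0 fun z hz => ?_
      rw [MajorityVote.mem_correctEvent_vote] at hz
      refine ⟨MeasureTheory.measureReal_nonneg, ?_⟩
      have h1 := hS.partitionMax_le (MajorityVote.agreeSet f z)
      rw [MajorityVote.partitionMax_of_lt hz] at h1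
      rw [MajorityVote.categorical_real_lossSet hα]
      linarith [hsum (MajorityVote.agreeSet f z), hα.2]
    · refine MajorityVote.integral_gibbsLoss_cond_mem_Icc hf D _ he h0 fun z hz => ?_
      rw [MajorityVote.mem_errorEvent_vote] at hz
      refine ⟨?_, MeasureTheory.measureReal_le_one⟩
      have h1 := hS.partitionMax_le (MajorityVote.agreeSet f z)
      rwa [MajorityVote.partitionMax_of_le hz,
        ← MajorityVote.categorical_real_lossSet hα] at h1
  · have := MajorityVote.isProbabilityMeasure_dirichlet hα
    have : Nonempty (Fin n) := ⟨⟨0, hn⟩⟩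
    have hl1 : MajorityVote.l1Norm α = ∑ i, α i :=
      Finset.sum_congr rfl fun i _ => abs_of_pos (hα i)
    have hpos : 0 < ∑ i, α i := Finset.sum_pos (fun i _ => hα i) Finset.univ_nonempty
    have hnonneg : ∀ A : Finset (Fin n), 0 ≤ ∑ i ∈ A, α i :=
      fun A => Finset.sum_nonneg fun i _ => (hα i).le
    have hmax : 0 ≤ MajorityVote.partitionMax α S := (hnonneg S).trans (le_max_left _ _)
    refine ⟨fun h0 => ?_, fun h0 => ?_⟩
    · refine MajorityVote.integral_gibbsLoss_cond_mem_Icc hf D _ hc h0 fun z hz => ?_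
      rw [MajorityVote.mem_correctEvent_vote] at hz
      refine ⟨MeasureTheory.measureReal_nonneg, ?_⟩
      have h1 := hS.partitionMax_le (MajorityVote.agreeSet f z)
      rw [MajorityVote.partitionMax_of_lt hz] at h1
      rw [MajorityVote.dirichlet_real_lossSet hn hα, hl1]
      -- On a correct example `A` is the larger part, so its sum is at least that of the optimal
      -- larger part, with the same total.
      exact MajorityVote.regIncBeta_half_le hmax h1 (hnonneg _)
        (by rw [hsum]; ring) (by linarith)
    · refine MajorityVote.integral_gibbsLoss_cond_mem_Icc hf D _ he h0 fun z hz => ?_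
      rw [MajorityVote.mem_errorEvent_vote] at hz
      refine ⟨?_, MeasureTheory.measureReal_le_one⟩
      have h1 := hS.partitionMax_le (MajorityVote.agreeSet f z)
      rw [MajorityVote.partitionMax_of_le hz] at h1
      rw [MajorityVote.dirichlet_real_lossSet hn hα, hl1]
      have h2 := hsum (MajorityVote.agreeSet f z)
      exact MajorityVote.regIncBeta_half_le (hnonneg _) (by linarith) hmax
        (by rw [h2]; ring) (by linarith)
  · refine MajorityVote.integral_gibbsLoss_cond_mem_Icc hf D _ hc h0 fun z hz => ?_
    rw [MajorityVote.mem_correctEvent_vote] at hz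
    rw [MajorityVote.gaussian_real_lossSet hn, ← MajorityVote.partitionGap_of_lt hz]
    exact ⟨MajorityVote.gaussTail_antitone (div_le_div_of_nonneg_right
        (MajorityVote.partitionGap_le_l1Norm α _) (Real.sqrt_nonneg _)),
      MajorityVote.gaussTail_antitone (div_le_div_of_nonneg_right (hS _) (Real.sqrt_nonneg _))⟩
  · refine MajorityVote.integral_gibbsLoss_cond_mem_Icc hf D _ he h0 fun z hz => ?_
    rw [MajorityVote.mem_errorEvent_vote] at hz
    -- Writing `1 - Φ(k)` as `Φ(-k)` reduces both bounds to comparing arguments, since on an error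
    -- the margin is minus the gap.
    rw [MajorityVote.gaussian_real_lossSet hn, ← MajorityVote.gaussTail_neg,
      ← MajorityVote.gaussTail_neg, ← neg_sub, ← MajorityVote.partitionGap_of_le hz, neg_div]
    exact ⟨MajorityVote.gaussTail_antitone (neg_le_neg (div_le_div_of_nonneg_right (hS _)
        (Real.sqrt_nonneg _))),
      MajorityVote.gaussTail_antitone (neg_le_neg (div_le_div_of_nonneg_right
        (MajorityVote.partitionGap_le_l1Norm α _) (Real.sqrt_nonneg _)))⟩
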